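/- A one-way Kondacs--Watrous quantum finite automaton (1KWQFA) over an input alphabet $\Sigma$ consists of a finite set $Q$ of internal states, disjoint sets $Q_a, Q_r \subseteq Q$ of accepting and rejecting states, an initial state in $Q_n = Q \setminus (Q_a \cup Q_r)$, a head movement $D(q) \in \{\downarrow, \rightarrow\}$ for each $q \in Q$ (the head stays, or moves one square to the right, whenever state $q$ is entered), and a unitary matrix $U_\sigma \in \mathbb{C}^{Q \times Q}$ for each $\sigma \in \Sigma \cup \{\vdash, \dashv\}$, where $\vdash$ and $\dashv$ are end markers not in $\Sigma$. On input $w \in \Sigma^*$ the tape holds $\vdash w \dashv$, and the machine starts in its initial state with the head on $\vdash$. The configurations are the pairs of an internal state and a head position; in each step the machine goes from $(q,i)$, where the head scans $\sigma$, to $q'$ with the head moved according to $D(q')$, with amplitude $U_\sigma[q',q]$, and then it is measured whether the internal state is accepting, rejecting or nonhalting. The computation stops with acceptance or rejection in the first two cases, and continues with the superposition projected to the nonhalting configurations in the third. It is required that the head never leaves the squares holding $\vdash w \dashv$. The acceptance probability $f_{\mathcal M}(w)$ is the sum over all steps of the probability of accepting at that step. A language $L \subseteq \Sigma^*$ is recognized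 by $\mathcal M$ with unbounded error if there is a $\lambda \in \mathbb{R}$ such that $L = \{w : f_{\mathcal M}(w) > \lambda\}$ or $L = \{w : f_{\mathcal M}(w) \ge \lambda\}$. **Theorem.** There exists a 1KWQFA $\mathcal M$ over the alphabet $\{a,b\}$ that recognizes with unbounded error the language $$L_{NH} = \Big\{a^{x}ba^{y_1}ba^{y_2}b\cdots a^{y_t}b \;\Big|\; x,t,y_1,\dots,y_t \in \mathbb{Z}^+ \text{ and } \exists k\ (1 \le k \le t),\ x = \sum_{i=1}^{k} y_i\Big\}.$$ More precisely, $f_{\mathcal M}(w) = \frac12$ for every $w \in \{a,b\}^* \setminus L_{NH}$, and $f_{\mathcal M}(w) > \frac12$ for every $w \in L_{NH}$. -/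

import Mathlib

/-- The input alphabet `{a, b}`. -/
inductive AB where
  | a
  | b
  deriving DecidableEq

/-- The tape alphabet `Σ ∪ {¢, $}`: the input alphabet extended by the two end markers. -/
inductive TapeSymbol (α : Type) where
  | leftEnd
  | letter (x : α)
  | rightEnd

/-- The head movements of a one-way machine. -/
inductive HeadMove where
  | stay
  | right
  deriving DecidableEq

/-- A one-way Kondacs–Watrous quantum finite automaton over the alphabet `α` with finite set of
internal states `Q`. The machine is unidirectional: the head movement is a function `move` of the
internal state being entered. `U σ q' q` is the amplitude with which the machine enters `q'` when
it reads `σ` in state `q`; each of the matrices `U σ` is unitary. The states that are neither in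
`accept` nor in `reject` are the nonhalting ones. -/
structure OneWayKWQFA (α Q : Type) [Fintype Q] [DecidableEq Q] where
  U : TapeSymbol α → Matrix Q Q ℂ
  unitary : ∀ σ, U σ ∈ Matrix.unitaryGroup Q ℂ
  move : Q → HeadMove
  start : Q
  accept : Finset Q
  reject : Finset Q
  disjoint : Disjoint accept reject
  start_nonhalting : start ∉ accept ∧ start ∉ reject

namespace OneWayKWQFA

variable {α Q : Type} [Fintype Q] [DecidableEq Q]

/-- The symbol on square `i` of the tape holding `¢ w $`: the left end marker is on square `0`, the
letters of `w` are on the squares `1, …, |w|`, and the right end marker is on square `|w| + 1`. -/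
def tape (w : List α) (i : Fin (w.length + 2)) : TapeSymbol α :=
  if (i : ℕ) = 0 then TapeSymbol.leftEnd
  else (w[(i : ℕ) - 1]?).elim TapeSymbol.rightEnd TapeSymbol.letter

/-- The configurations of a machine on input `w`: internal state and head position. -/
abbrev Config (Q : Type) (w : List α) : Type := Q × Fin (w.length + 2)

/-- The head position after the movement `d` from square `i`. The addition is modulo the length of
the tape, which makes the evolution of the whole (finite) configuration space unitary; the wrap-around
is never used by a machine satisfying `StaysOnTape`. -/
def shift {n : ℕ} (d : HeadMove) (i : Fin (n + 2)) : Fin (n + 2) :=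
  match d with
  | HeadMove.stay => i
  | HeadMove.right => i + 1

/-- The configuration transition matrix on input `w`. -/
def configMatrix (M : OneWayKWQFA α Q) (w : List α) : Matrix (Config Q w) (Config Q w) ℂ :=
  fun c' c => if c'.2 = shift (M.move c'.1) c.2 then M.U (tape w c.2) c'.1 c.1 else 0

/-- The (unnormalized) nonhalting superposition after `k` steps on input `w`. The computation starts
in the initial state with the head on `¢`; in each step the configuration matrix is applied, and then
the superposition is projected to the nonhalting configurations. -/
noncomputable def superposition (M : OneWayKWQFA α Q) (w : List α) : ℕ → Config Q w → ℂ
  | 0 => Pi.single (M.start, 0) 1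
  | k + 1 => fun c =>
      if c.1 ∈ M.accept ∨ c.1 ∈ M.reject then 0
      else (M.configMatrix w).mulVec (superposition M w k) c

/-- The probability that the input `w` is accepted by the measurement at step `k + 1`. -/
noncomputable def acceptAt (M : OneWayKWQFA α Q) (w : List α) (k : ℕ) : ℝ :=
  ∑ c : Config Q w with c.1 ∈ M.accept, ‖(M.configMatrix w).mulVec (M.superposition w k) c‖ ^ 2

theorem shift_injective {n : ℕ} (d : HeadMove) : Function.Injective (shift (n := n) d) := by
  intro i j h
  cases d with
  | stay => exact h
  | right => exact add_right_cancel h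

/-- The evolution of the configurations is unitary. -/
theorem configMatrix_mem_unitaryGroup (M : OneWayKWQFA α Q) (w : List α) :
    M.configMatrix w ∈ Matrix.unitaryGroup (Config Q w) ℂ := by
  rw [Matrix.mem_unitaryGroup_iff']
  ext ⟨q₁, i₁⟩ ⟨q₂, i₂⟩
  rw [Matrix.star_eq_conjTranspose, Matrix.mul_apply, Fintype.sum_prod_type]
  simp only [Matrix.conjTranspose_apply, configMatrix]
  have hU := congrFun (congrFun (Matrix.mem_unitaryGroup_iff'.mp (M.unitary (tape w i₁))) q₁) q₂
  rw [Matrix.star_eq_conjTranspose, Matrix.mul_apply] at hU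
  simp only [Matrix.conjTranspose_apply] at hU
  by_cases hi : i₁ = i₂
  · subst hi
    have key : ∀ q : Q, (∑ j, star (if j = shift (M.move q) i₁ then M.U (tape w i₁) q q₁ else 0) *
        (if j = shift (M.move q) i₁ then M.U (tape w i₁) q q₂ else 0)) =
        star (M.U (tape w i₁) q q₁) * M.U (tape w i₁) q q₂ := by
      intro q
      rw [Finset.sum_eq_single (shift (M.move q) i₁)]
      · simp
      · intro j _ hj
        simp [hj]
      · simp
    rw [Finset.sum_congr rfl fun q _ => key q, hU]
    simp [Matrix.one_apply]
  · rw [Matrix.one_apply_ne (by simp [hi])]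
    refine Finset.sum_eq_zero fun q _ => Finset.sum_eq_zero fun j _ => ?_
    by_cases h₁ : j = shift (M.move q) i₁
    · have h₂ : j ≠ shift (M.move q) i₂ := fun h => hi (shift_injective _ (h₁.symm.trans h))
      rw [if_neg h₂, mul_zero]
    · rw [if_neg h₁, star_zero, zero_mul]

theorem sum_norm_sq_configMatrix_mulVec (M : OneWayKWQFA α Q) (w : List α) (v : Config Q w → ℂ) :
    ∑ c, ‖(M.configMatrix w).mulVec v c‖ ^ 2 = ∑ c, ‖v c‖ ^ 2 := by
  have aux : ∀ u : Config Q w → ℂ, ((∑ c, ‖u c‖ ^ 2 : ℝ) : ℂ) = dotProduct (star u) u := by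
    intro u
    simp [dotProduct, Complex.conj_mul']
  have h := Matrix.mem_unitaryGroup_iff'.mp (M.configMatrix_mem_unitaryGroup w)
  have : ((∑ c, ‖(M.configMatrix w).mulVec v c‖ ^ 2 : ℝ) : ℂ) = ((∑ c, ‖v c‖ ^ 2 : ℝ) : ℂ) := by
    rw [aux, aux, Matrix.star_mulVec, Matrix.dotProduct_mulVec, Matrix.vecMul_vecMul,
      ← Matrix.star_eq_conjTranspose, h, Matrix.vecMul_one]
  exact_mod_cast this

theorem sum_acceptAt_add_le (M : OneWayKWQFA α Q) (w : List α) (n : ℕ) :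
    ∑ k ∈ Finset.range n, M.acceptAt w k + ∑ c, ‖M.superposition w n c‖ ^ 2 ≤ 1 := by
  induction n with
  | zero =>
    rw [Finset.sum_eq_single ((M.start, 0) : Config Q w)]
    · simp [superposition]
    · intro c _ hc
      simp [superposition, hc]
    · simp
  | succ n ih =>
    have step : M.acceptAt w n + ∑ c, ‖M.superposition w (n + 1) c‖ ^ 2 ≤
        ∑ c, ‖M.superposition w n c‖ ^ 2 := by
      rw [← M.sum_norm_sq_configMatrix_mulVec w (M.superposition w n), acceptAt,
        Finset.sum_filter, ← Finset.sum_add_distrib]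
      refine Finset.sum_le_sum fun c _ => ?_
      by_cases h : c.1 ∈ M.accept
      · simp [superposition, h]
      · by_cases h' : c.1 ∈ M.reject
        · simp [superposition, h, h']
        · simp [superposition, h, h']
    rw [Finset.sum_range_succ]
    linarith

/-- The acceptance probabilities of the single steps are summable, with sum at most `1`. -/
theorem summable_acceptAt (M : OneWayKWQFA α Q) (w : List α) : Summable (M.acceptAt w) := by
  refine summable_of_sum_range_le (c := 1) (fun k => ?_) (fun n => ?_)
  · exact Finset.sum_nonneg fun c _ => by positivity
  · have h := M.sum_acceptAt_add_le w n
    have : 0 ≤ ∑ c, ‖M.superposition w n c‖ ^ 2 := Finset.sum_nonneg fun c _ => by positivity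
    linarith

/-- The overall acceptance probability `f_M(w)`. -/
noncomputable def acceptProb (M : OneWayKWQFA α Q) (w : List α) : ℝ :=
  ∑' k : ℕ, M.acceptAt w k

/-- On no input does the head ever leave the part of the tape holding `¢ w $`: at every step, every
state entered with a movement to the right is entered from the right end marker with amplitude
zero. -/
def StaysOnTape (M : OneWayKWQFA α Q) : Prop :=
  ∀ (w : List α) (k : ℕ) (q' : Q), M.move q' = HeadMove.right →
    ∑ q : Q, M.U TapeSymbol.rightEnd q' q * M.superposition w k (q, Fin.last _) = 0

/-- `L` is recognized by `M` with strict cutpoint `cut`. -/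
def RecognizesWithCutpoint (M : OneWayKWQFA α Q) (cut : ℝ) (L : Language α) : Prop :=
  ∀ w : List α, w ∈ L ↔ cut < M.acceptProb w

/-- `L` is recognized by `M` with nonstrict cutpoint `cut`. -/
def RecognizesWithNonstrictCutpoint (M : OneWayKWQFA α Q) (cut : ℝ) (L : Language α) : Prop :=
  ∀ w : List α, w ∈ L ↔ cut ≤ M.acceptProb w

/-- `L` is recognized by `M` with unbounded error. -/
def RecognizesWithUnboundedError (M : OneWayKWQFA α Q) (L : Language α) : Prop :=
  ∃ cut : ℝ, M.RecognizesWithCutpoint cut L ∨ M.RecognizesWithNonstrictCutpoint cut L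

end OneWayKWQFA

/-- The language of all words `a^x b a^{y₁} b a^{y₂} b ⋯ a^{y_t} b` with `x, t, y₁, …, y_t` positive
and `x = y₁ + ⋯ + y_k` for some `1 ≤ k ≤ t`. -/
def LNH : Language AB :=
  {w | ∃ (x : ℕ) (y : List ℕ), 0 < x ∧ y ≠ [] ∧ (∀ i ∈ y, 0 < i) ∧
    (∃ k : ℕ, 1 ≤ k ∧ k ≤ y.length ∧ x = (y.take k).sum) ∧
    w = List.replicate x AB.a ++ [AB.b] ++
      y.flatMap (fun i => List.replicate i AB.a ++ [AB.b])}

/-!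
The quantum automaton simulates a one-way nondeterministic machine with stay moves, in such a way
that only the *arrival times* of runs at the right end marker matter.

**Simulation.** On nonhalting states the automaton applies `ε` times the 0-1 transition matrix of the
nondeterministic machine, for a small `ε > 0`. The result is a contraction, which becomes unitary
after adding one accepting and one rejecting copy of the states (`Matrix.exists_unitary_of_gram`).
All amplitudes of nonhalting configurations are nonnegative reals, positive exactly for the
configurations that are reachable at that time (`OneWayNFA.simulation_superposition_inl`). The lost
norm is divided equally between acceptance and rejection, except on the right end marker: there, two
chosen states `p` and `q` interfere, and acceptance exceeds rejection by a positive multiple of the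
product of their amplitudes. Since at least half of the norm halts in each step, the halting
probabilities add up to `1`. So the acceptance probability is `1 / 2`, plus a positive amount if and
only if `p` and `q` can be reached on the right end marker at the same time
(`OneWayNFA.exists_simulation`).

**The machine for `LNH`.** One component checks deterministically that the input is of the form
`a^x b a^{y₁} b ⋯ a^{y_t} b`, spending two steps on each letter of `a^x` and one step on every other
letter. It arrives at time `|w| + 1 + x`. The other component spends two steps on each `a` between
the first `b` and a guessed later `b`, hence arrives at time `|w| + 1 + (y₁ + ⋯ + y_k)`, where the
guessed `b` ends the `k`-th block. The arrival times can coincide exactly for the words of `LNH`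
(`lnhMachine_simultaneous_iff`); `x > 0` holds then, as the `y_i` are positive.
-/

/-! ### Completing contractions to unitary matrices -/

open scoped Matrix ComplexOrder in
theorem Matrix.norm_star_dotProduct_mulVec_le {S : Type*} [Fintype S] {H : Matrix S S ℂ} {C : ℝ}
    (hH : ∀ i j, ‖H i j‖ ≤ C) (x : S → ℂ) :
    ‖star x ⬝ᵥ H *ᵥ x‖ ≤ Fintype.card S * C * ∑ i, ‖x i‖ ^ 2 := by
  have hterm : ∀ i j, ‖star (x i) * (H i j * x j)‖ ≤ C * ((‖x i‖ ^ 2 + ‖x j‖ ^ 2) / 2) := by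
    intro i j
    have hC : 0 ≤ C := (norm_nonneg _).trans (hH i j)
    rw [norm_mul, norm_mul, norm_star]
    calc ‖x i‖ * (‖H i j‖ * ‖x j‖) = ‖H i j‖ * (‖x i‖ * ‖x j‖) := by ring
      _ ≤ C * ((‖x i‖ ^ 2 + ‖x j‖ ^ 2) / 2) := by
        refine mul_le_mul (hH i j) ?_ (by positivity) hC
        linarith [two_mul_le_add_sq ‖x i‖ ‖x j‖]
  calc ‖star x ⬝ᵥ H *ᵥ x‖ = ‖∑ i, ∑ j, star (x i) * (H i j * x j)‖ := by
        simp [dotProduct, Matrix.mulVec, Finset.mul_sum]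
    _ ≤ ∑ i, ∑ j, C * ((‖x i‖ ^ 2 + ‖x j‖ ^ 2) / 2) :=
        (norm_sum_le _ _).trans <| Finset.sum_le_sum fun i _ =>
          (norm_sum_le _ _).trans <| Finset.sum_le_sum fun j _ => hterm i j
    _ = Fintype.card S * C * ∑ i, ‖x i‖ ^ 2 := by
        simp only [← Finset.mul_sum, ← Finset.sum_div, Finset.sum_add_distrib, Finset.sum_const,
          Finset.card_univ, nsmul_eq_mul]
        ring

open scoped Matrix ComplexOrder in
/-- A Hermitian matrix with sufficiently small entries has norm at most `1`. -/
theorem Matrix.IsHermitian.posSemidef_one_sub {S : Type*} [Fintype S] [DecidableEq S]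
    {H : Matrix S S ℂ} (hH : H.IsHermitian) {C : ℝ} (hC : ∀ i j, ‖H i j‖ ≤ C)
    (hle : Fintype.card S * C ≤ 1) : (1 - H).PosSemidef := by
  refine .of_dotProduct_mulVec_nonneg (Matrix.isHermitian_one.sub hH) fun x => ?_
  have hreal : (star x ⬝ᵥ H *ᵥ x).im = 0 := hH.im_star_dotProduct_mulVec_self x
  have hx : star x ⬝ᵥ x = ((∑ i, ‖x i‖ ^ 2 : ℝ) : ℂ) := by
    simp [dotProduct, Complex.conj_mul']
  have hb := Matrix.norm_star_dotProduct_mulVec_le hC x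
  have hs : 0 ≤ ∑ i, ‖x i‖ ^ 2 := Finset.sum_nonneg fun i _ => by positivity
  have hre : (star x ⬝ᵥ H *ᵥ x).re ≤ ∑ i, ‖x i‖ ^ 2 :=
    (Complex.re_le_norm _).trans (hb.trans (mul_le_of_le_one_left hs hle))
  rw [Matrix.sub_mulVec, Matrix.one_mulVec, dotProduct_sub, hx, Complex.nonneg_iff]
  constructor
  · rw [Complex.sub_re, Complex.ofReal_re]
    linarith
  · rw [Complex.sub_im, Complex.ofReal_im, hreal, sub_zero]

open scoped Matrix in
/-- An isometry is a block of columns of a unitary matrix. -/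
theorem Matrix.exists_unitary_extension {S R : Type*} [Fintype S] [Fintype R] [DecidableEq S]
    [DecidableEq R] (V : Matrix (S ⊕ R) S ℂ) (hV : Vᴴ * V = 1) :
    ∃ U ∈ Matrix.unitaryGroup (S ⊕ R) ℂ, ∀ q s, U q (Sum.inl s) = V q s := by
  have horth : Orthonormal ℂ ((Set.range (Sum.inl : S → S ⊕ R)).domRestrict
      fun q : S ⊕ R => WithLp.toLp 2 fun q' : S ⊕ R => q.elim (fun s => V q' s) 0) := by
    rw [orthonormal_iff_ite]
    rintro ⟨_, s, rfl⟩ ⟨_, t, rfl⟩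
    have h := congrFun (congrFun hV s) t
    rw [Matrix.mul_apply, Matrix.one_apply] at h
    simpa [PiLp.inner_apply, mul_comm, Subtype.ext_iff] using h
  obtain ⟨b, hb⟩ := horth.exists_orthonormalBasis_extension_of_card_eq (by simp)
  refine ⟨Matrix.of fun q' q => b q q', ?_, fun q s => ?_⟩
  · rw [Matrix.mem_unitaryGroup_iff']
    ext q₁ q₂
    rw [Matrix.star_eq_conjTranspose, Matrix.mul_apply, Matrix.one_apply,
      ← orthonormal_iff_ite.mp b.orthonormal q₁ q₂]
    simp [PiLp.inner_apply, mul_comm]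
  · simp [hb (Sum.inl s) ⟨s, rfl⟩]

open scoped Matrix ComplexOrder MatrixOrder in
/-- A matrix `T` is the upper left corner of a unitary matrix in which the two blocks below `T` have
prescribed Gram matrices `A` and `B`, provided that the three Gram matrices add up to the identity.
-/
theorem Matrix.exists_unitary_of_gram {S : Type*} [Fintype S] [DecidableEq S]
    {T A B : Matrix S S ℂ} (hA : A.PosSemidef) (hB : B.PosSemidef) (h : Tᴴ * T + (A + B) = 1) :
    ∃ U ∈ Matrix.unitaryGroup (S ⊕ (S ⊕ S)) ℂ,
      (∀ s' s, U (Sum.inl s') (Sum.inl s) = T s' s) ∧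
      (∀ x : S → ℂ, ∑ s', ‖∑ s, U (Sum.inr (Sum.inl s')) (Sum.inl s) * x s‖ ^ 2 =
        (star x ⬝ᵥ A *ᵥ x).re) ∧
      (∀ x : S → ℂ, ∑ s', ‖∑ s, U (Sum.inr (Sum.inr s')) (Sum.inl s) * x s‖ ^ 2 =
        (star x ⬝ᵥ B *ᵥ x).re) := by
  obtain ⟨A', rfl⟩ := CStarAlgebra.nonneg_iff_eq_star_mul_self.mp hA.nonneg
  obtain ⟨B', rfl⟩ := CStarAlgebra.nonneg_iff_eq_star_mul_self.mp hB.nonneg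
  have hnorm : ∀ (C : Matrix S S ℂ) (x : S → ℂ),
      ∑ s', ‖∑ s, C s' s * x s‖ ^ 2 = (star x ⬝ᵥ (star C * C) *ᵥ x).re := by
    intro C x
    rw [Matrix.star_eq_conjTranspose, ← Matrix.mulVec_mulVec, Matrix.dotProduct_mulVec,
      ← Matrix.star_mulVec, ← Complex.ofReal_re (∑ s', _)]
    congr 1
    rw [Complex.ofReal_sum]
    refine Finset.sum_congr rfl fun i _ => ?_
    rw [Complex.ofReal_pow]
    exact (Complex.conj_mul' _).symm
  obtain ⟨U, hU, hUV⟩ := Matrix.exists_unitary_extension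
    (Matrix.fromRows T (Matrix.fromRows A' B')) (by
      rw [Matrix.conjTranspose_fromRows_eq_fromCols_conjTranspose,
        Matrix.conjTranspose_fromRows_eq_fromCols_conjTranspose, Matrix.fromCols_mul_fromRows,
        Matrix.fromCols_mul_fromRows]
      exact h)
  refine ⟨U, hU, fun s' s => by simp [hUV], fun x => ?_, fun x => ?_⟩ <;>
    rw [← hnorm] <;> simp [hUV]

/-! ### Unitary matrices simulating nondeterministic steps -/

/-- A one-way nondeterministic machine on the tape `¢ w $`. As for `OneWayKWQFA`, the head movement
is a function of the state being entered. No step is possible on the right end marker. -/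
structure OneWayNFA (α S : Type) where
  /-- `step σ s s'`: reading `σ` in state `s`, the machine may enter `s'`. -/
  step : TapeSymbol α → S → S → Prop
  move : S → HeadMove
  start : S
  not_step_rightEnd : ∀ s s', ¬ step TapeSymbol.rightEnd s s'

namespace OneWayNFA

open OneWayKWQFA

variable {α S : Type}

/-- `N.Reaches w k c`: on input `w` some run of `N` is in the configuration `c` after exactly `k`
steps. -/
def Reaches (N : OneWayNFA α S) (w : List α) : ℕ → Config S w → Prop
  | 0, c => c = (N.start, 0)
  | k + 1, c => ∃ c' : Config S w, Reaches N w k c' ∧ N.step (tape w c'.2) c'.1 c.1 ∧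
      c.2 = shift (N.move c.1) c'.2

variable [Fintype S] [DecidableEq S]

open scoped Matrix ComplexOrder in
/-- The unitary matrices of the simulation of `N`. On the nonhalting states they act as `ε` times
the transition matrix of `N`, where `ε` is so small that at least half of the norm is lost. What is
lost goes to accepting and rejecting states in equal parts, except that on the right end marker the
overlap of the amplitudes of `p` and `q` shifts the balance towards acceptance. -/
theorem exists_unitary (N : OneWayNFA α S) (p q : S) :
    ∃ ε > (0 : ℝ), ∃ η > (0 : ℝ), ∃ U : TapeSymbol α → Matrix (S ⊕ (S ⊕ S)) (S ⊕ (S ⊕ S)) ℂ,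
      (∀ σ, U σ ∈ Matrix.unitaryGroup (S ⊕ (S ⊕ S)) ℂ) ∧
      (∀ σ s s', N.step σ s s' → U σ (Sum.inl s') (Sum.inl s) = (ε : ℂ)) ∧
      (∀ σ s s', ¬ N.step σ s s' → U σ (Sum.inl s') (Sum.inl s) = 0) ∧
      (∀ σ (x : S → ℂ), 1 / 2 * ∑ s, ‖x s‖ ^ 2 ≤
        ∑ s', ‖∑ s, U σ (Sum.inr (Sum.inl s')) (Sum.inl s) * x s‖ ^ 2 +
        ∑ s', ‖∑ s, U σ (Sum.inr (Sum.inr s')) (Sum.inl s) * x s‖ ^ 2) ∧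
      (∀ σ, σ ≠ TapeSymbol.rightEnd → ∀ x : S → ℂ,
        ∑ s', ‖∑ s, U σ (Sum.inr (Sum.inl s')) (Sum.inl s) * x s‖ ^ 2 =
        ∑ s', ‖∑ s, U σ (Sum.inr (Sum.inr s')) (Sum.inl s) * x s‖ ^ 2) ∧
      (∀ x : S → ℂ,
        ∑ s', ‖∑ s, U TapeSymbol.rightEnd (Sum.inr (Sum.inl s')) (Sum.inl s) * x s‖ ^ 2 =
        ∑ s', ‖∑ s, U TapeSymbol.rightEnd (Sum.inr (Sum.inr s')) (Sum.inl s) * x s‖ ^ 2 +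
        η * (star (x p) * x q).re) := by
  classical
  have hn : 0 < (Fintype.card S : ℝ) := by exact_mod_cast Fintype.card_pos_iff.mpr ⟨N.start⟩
  set n : ℝ := (Fintype.card S : ℝ) with hn_def
  -- With these constants, the Gram matrix of the nonhalting part and the matrix `K η` below have
  -- entries of absolute value at most `1 / (4 * n)`, which bounds their norms by `1 / 4`.
  set ε : ℝ := 1 / (2 * n) with hε
  have hε0 : 0 < ε := by positivity
  set η : ℝ := 1 / (8 * n) with hη
  have hη0 : 0 < η := by positivity
  -- the difference of the Gram matrices of acceptance and rejection, for a given weight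
  let K : ℝ → Matrix S S ℂ := fun c => (c : ℂ) • (Matrix.single p q 1 + Matrix.single q p 1)
  have hKherm : ∀ c, (K c).IsHermitian := by
    intro c
    simp only [K, Matrix.IsHermitian, Matrix.conjTranspose_smul, Matrix.conjTranspose_add,
      Matrix.conjTranspose_single, star_one, Complex.star_def, Complex.conj_ofReal]
    rw [add_comm]
  have hKquad : ∀ c x, (star x ⬝ᵥ K c *ᵥ x).re = 2 * c * (star (x p) * x q).re := by
    intro c x
    have hsingle : ∀ a b : S, star x ⬝ᵥ Matrix.single a b (1 : ℂ) *ᵥ x = star (x a) * x b := by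
      intro a b
      rw [Matrix.single_mulVec, one_mul]
      exact dotProduct_single (star x) (x b) a
    simp only [K, Matrix.smul_mulVec, Matrix.add_mulVec, dotProduct_smul, dotProduct_add, hsingle,
      smul_eq_mul, Complex.ofReal_re, Complex.ofReal_im, Complex.add_re, Complex.star_def,
      Complex.mul_re,
      Complex.conj_re, Complex.conj_im]
    ring
  have hKle : ∀ c, 0 ≤ c → c ≤ η → ∀ i j, ‖K c i j‖ ≤ 1 / (4 * n) := by
    intro c hc0 hc i j
    have h1 : ∀ a b : S, ‖Matrix.single a b (1 : ℂ) i j‖ ≤ 1 := by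
      intro a b
      rw [Matrix.single_apply]
      split_ifs <;> simp
    calc ‖K c i j‖ = c * ‖Matrix.single p q (1 : ℂ) i j + Matrix.single q p (1 : ℂ) i j‖ := by
          simp only [K, Matrix.smul_apply, norm_smul, Complex.norm_real, Real.norm_of_nonneg hc0,
            Matrix.add_apply]
      _ ≤ c * (1 + 1) := by
          gcongr
          exact (norm_add_le _ _).trans (add_le_add (h1 _ _) (h1 _ _))
      _ ≤ η * (1 + 1) := by gcongr
      _ = 1 / (4 * n) := by rw [hη]; field_simp; norm_num
  let T : TapeSymbol α → Matrix S S ℂ := fun σ =>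
    Matrix.of fun s' s => if N.step σ s s' then (ε : ℂ) else 0
  have hTle : ∀ σ i j, ‖((T σ)ᴴ * T σ) i j‖ ≤ 1 / (4 * n) := by
    intro σ i j
    have h1 : ∀ a b, ‖T σ a b‖ ≤ ε := by
      intro a b
      simp only [T, Matrix.of_apply]
      split_ifs
      · simp [abs_of_pos hε0]
      · simpa using hε0.le
    calc ‖((T σ)ᴴ * T σ) i j‖ ≤ ∑ a, ‖(T σ)ᴴ i a * T σ a j‖ := norm_sum_le _ _
      _ ≤ ∑ _a : S, ε * ε := by
          refine Finset.sum_le_sum fun a _ => ?_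
          rw [norm_mul, Matrix.conjTranspose_apply, norm_star]
          exact mul_le_mul (h1 _ _) (h1 _ _) (norm_nonneg _) hε0.le
      _ = 1 / (4 * n) := by
          rw [Finset.sum_const, Finset.card_univ, nsmul_eq_mul, ← hn_def, hε]
          field_simp
          norm_num
  have hTherm : ∀ σ, ((T σ)ᴴ * T σ).IsHermitian := fun σ =>
    Matrix.isHermitian_conjTranspose_mul_self _
  -- the matrices for a single symbol
  have key : ∀ σ : TapeSymbol α,
      ∃ U ∈ Matrix.unitaryGroup (S ⊕ (S ⊕ S)) ℂ,
        (∀ s' s, U (Sum.inl s') (Sum.inl s) = T σ s' s) ∧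
        ∀ x : S → ℂ,
          1 / 2 * ∑ s, ‖x s‖ ^ 2 ≤
            ∑ s', ‖∑ s, U (Sum.inr (Sum.inl s')) (Sum.inl s) * x s‖ ^ 2 +
            ∑ s', ‖∑ s, U (Sum.inr (Sum.inr s')) (Sum.inl s) * x s‖ ^ 2 ∧
          ∑ s', ‖∑ s, U (Sum.inr (Sum.inl s')) (Sum.inl s) * x s‖ ^ 2 =
            ∑ s', ‖∑ s, U (Sum.inr (Sum.inr s')) (Sum.inl s) * x s‖ ^ 2 +
            2 * (if σ = TapeSymbol.rightEnd then η else 0) * (star (x p) * x q).re := by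
    intro σ
    obtain ⟨hc0, hc⟩ : 0 ≤ (if σ = TapeSymbol.rightEnd then η else 0) ∧
        (if σ = TapeSymbol.rightEnd then η else 0) ≤ η := by
      split_ifs
      · exact ⟨hη0.le, le_rfl⟩
      · exact ⟨le_rfl, hη0.le⟩
    generalize (if σ = TapeSymbol.rightEnd then η else 0) = c at *
    have hsmall : n * (1 / (4 * n) + 1 / (4 * n)) ≤ 1 := by
      field_simp
      norm_num
    have hA : (1 - ((T σ)ᴴ * T σ - K c)).PosSemidef :=
      ((hTherm σ).sub (hKherm c)).posSemidef_one_sub (fun i j =>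
        (norm_sub_le _ _).trans (add_le_add (hTle σ i j) (hKle c hc0 hc i j))) hsmall
    have hB : (1 - ((T σ)ᴴ * T σ + K c)).PosSemidef :=
      ((hTherm σ).add (hKherm c)).posSemidef_one_sub (fun i j =>
        (norm_add_le _ _).trans (add_le_add (hTle σ i j) (hKle c hc0 hc i j))) hsmall
    have half : (0 : ℂ) ≤ 1 / 2 := by
      rw [show (1 / 2 : ℂ) = ((1 / 2 : ℝ) : ℂ) by push_cast; rfl]
      exact Complex.zero_le_real.mpr (by norm_num)
    obtain ⟨U, hU, hUT, hUA, hUB⟩ := Matrix.exists_unitary_of_gram (T := T σ)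
      (hA.smul half) (hB.smul half) (by
        rw [← smul_add]
        ext i j
        simp only [Matrix.add_apply, Matrix.sub_apply, Matrix.smul_apply, smul_eq_mul]
        ring)
    refine ⟨U, hU, hUT, fun x => ?_⟩
    have hquad : (star x ⬝ᵥ ((T σ)ᴴ * T σ) *ᵥ x).re ≤ 1 / 4 * ∑ s, ‖x s‖ ^ 2 := by
      refine (Complex.re_le_norm _).trans
        ((Matrix.norm_star_dotProduct_mulVec_le (hTle σ) x).trans (le_of_eq ?_))
      rw [← hn_def]
      field_simp
    have hx : (star x ⬝ᵥ x).re = ∑ s, ‖x s‖ ^ 2 := by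
      rw [← Complex.ofReal_re (∑ s, ‖x s‖ ^ 2)]
      congr 1
      simp [dotProduct, Complex.conj_mul']
    have hs : 0 ≤ ∑ s, ‖x s‖ ^ 2 := Finset.sum_nonneg fun i _ => by positivity
    rw [hUA, hUB]
    have hre : ∀ z : ℂ, ((1 / 2 : ℂ) * z).re = 1 / 2 * z.re := by
      intro z
      rw [show (1 / 2 : ℂ) = ((1 / 2 : ℝ) : ℂ) by push_cast; rfl, Complex.re_ofReal_mul]
    simp only [Matrix.smul_mulVec, dotProduct_smul, smul_eq_mul, hre, Matrix.sub_mulVec,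
      Matrix.add_mulVec, Matrix.one_mulVec, dotProduct_sub, dotProduct_add, Complex.sub_re,
      Complex.add_re, hx, hKquad]
    constructor
    · linarith
    · ring
  choose V hVu hVT hV using key
  refine ⟨ε, hε0, 2 * η, by positivity, V, hVu, fun σ s s' h => ?_, fun σ s s' h => ?_,
    fun σ x => (hV σ x).1, fun σ hσ x => ?_, fun x => ?_⟩
  · simp [hVT, T, h]
  · simp [hVT, T, h]
  · rw [(hV σ x).2, if_neg hσ]
    ring
  · rw [(hV _ x).2, if_pos rfl]

end OneWayNFA

/-! ### Simulation of nondeterministic machines by 1KWQFAs -/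

namespace OneWayNFA

open OneWayKWQFA

variable {α S : Type} [Fintype S] [DecidableEq S]

/-- The 1KWQFA on the states of `N` (nonhalting), a copy of them that accepts and a copy that
rejects, with the given unitary matrices. -/
def simulation (N : OneWayNFA α S) (U : TapeSymbol α → Matrix (S ⊕ (S ⊕ S)) (S ⊕ (S ⊕ S)) ℂ)
    (hU : ∀ σ, U σ ∈ Matrix.unitaryGroup (S ⊕ (S ⊕ S)) ℂ) : OneWayKWQFA α (S ⊕ (S ⊕ S)) where
  U := U
  unitary := hU
  move := Sum.elim N.move fun _ => HeadMove.stay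
  start := Sum.inl N.start
  accept := Finset.univ.image (Sum.inr ∘ Sum.inl)
  reject := Finset.univ.image (Sum.inr ∘ Sum.inr)
  disjoint := by
    rw [Finset.disjoint_left]
    rintro _ h₁ h₂
    obtain ⟨s, -, rfl⟩ := Finset.mem_image.mp h₁
    obtain ⟨t, -, h⟩ := Finset.mem_image.mp h₂
    simp at h
  start_nonhalting := by simp

variable (N : OneWayNFA α S) {U : TapeSymbol α → Matrix (S ⊕ (S ⊕ S)) (S ⊕ (S ⊕ S)) ℂ}
  (hU : ∀ σ, U σ ∈ Matrix.unitaryGroup (S ⊕ (S ⊕ S)) ℂ) (w : List α)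

@[simp]
theorem simulation_U : (N.simulation U hU).U = U := rfl

@[simp]
theorem simulation_start : (N.simulation U hU).start = Sum.inl N.start := rfl

@[simp]
theorem simulation_move_inl (s : S) : (N.simulation U hU).move (Sum.inl s) = N.move s := rfl

@[simp]
theorem simulation_move_inr (h : S ⊕ S) :
    (N.simulation U hU).move (Sum.inr h) = HeadMove.stay := rfl

@[simp]
theorem mem_simulation_accept (x : S ⊕ (S ⊕ S)) :
    x ∈ (N.simulation U hU).accept ↔ ∃ s, x = Sum.inr (Sum.inl s) := by
  simp [simulation, eq_comm]

@[simp]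
theorem mem_simulation_reject (x : S ⊕ (S ⊕ S)) :
    x ∈ (N.simulation U hU).reject ↔ ∃ s, x = Sum.inr (Sum.inr s) := by
  simp [simulation, eq_comm]

@[simp]
theorem simulation_superposition_inr (k : ℕ) (h : S ⊕ S) (i : Fin (w.length + 2)) :
    (N.simulation U hU).superposition w k (Sum.inr h, i) = 0 := by
  cases k with
  | zero => simp [superposition]
  | succ k => cases h <;> simp [superposition]

theorem simulation_superposition_succ_inl_eq_mulVec (k : ℕ) (s : S) (j : Fin (w.length + 2)) :
    (N.simulation U hU).superposition w (k + 1) (Sum.inl s, j) =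
      ((N.simulation U hU).configMatrix w).mulVec ((N.simulation U hU).superposition w k)
        (Sum.inl s, j) := by
  simp [superposition]

theorem simulation_superposition_succ_inl (k : ℕ) (s : S) (j : Fin (w.length + 2)) :
    (N.simulation U hU).superposition w (k + 1) (Sum.inl s, j) =
      ∑ c : Config S w, (if j = shift (N.move s) c.2 then U (tape w c.2) (Sum.inl s) (Sum.inl c.1)
        else 0) * (N.simulation U hU).superposition w k (Sum.inl c.1, c.2) := by
  rw [simulation_superposition_succ_inl_eq_mulVec, Matrix.mulVec, dotProduct,
    Fintype.sum_prod_type, Fintype.sum_sum_type, Fintype.sum_prod_type]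
  simp only [simulation_superposition_inr, mul_zero, Finset.sum_const_zero, add_zero]
  rfl

theorem simulation_mulVec_inr (k : ℕ) (h : S ⊕ S) (j : Fin (w.length + 2)) :
    ((N.simulation U hU).configMatrix w).mulVec ((N.simulation U hU).superposition w k)
        (Sum.inr h, j) =
      ∑ s, U (tape w j) (Sum.inr h) (Sum.inl s) *
        (N.simulation U hU).superposition w k (Sum.inl s, j) := by
  rw [Matrix.mulVec, dotProduct, Fintype.sum_prod_type, Fintype.sum_sum_type]
  simp only [simulation_superposition_inr, mul_zero, Finset.sum_const_zero, add_zero]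
  refine Finset.sum_congr rfl fun s _ => ?_
  rw [Finset.sum_eq_single j]
  · simp [configMatrix, shift]
  · intro i _ hi
    simp [configMatrix, shift, hi.symm]
  · simp

theorem simulation_acceptAt (k : ℕ) :
    (N.simulation U hU).acceptAt w k = ∑ i, ∑ s',
      ‖∑ s, U (tape w i) (Sum.inr (Sum.inl s')) (Sum.inl s) *
        (N.simulation U hU).superposition w k (Sum.inl s, i)‖ ^ 2 := by
  simp only [← simulation_mulVec_inr]
  rw [acceptAt, Finset.sum_filter, Fintype.sum_prod_type, Finset.sum_comm]
  refine Finset.sum_congr rfl fun i _ => ?_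
  rw [Fintype.sum_sum_type, Fintype.sum_sum_type]
  simp

/-- The probability that the simulation rejects the input `w` at step `k + 1`. -/
noncomputable def simulationRejectAt (k : ℕ) : ℝ :=
  ∑ i, ∑ s', ‖∑ s, U (tape w i) (Sum.inr (Sum.inr s')) (Sum.inl s) *
        (N.simulation U hU).superposition w k (Sum.inl s, i)‖ ^ 2

theorem simulation_sum_norm_sq (k : ℕ) :
    ∑ c, ‖(N.simulation U hU).superposition w k c‖ ^ 2 =
      ∑ i, ∑ s, ‖(N.simulation U hU).superposition w k (Sum.inl s, i)‖ ^ 2 := by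
  rw [Fintype.sum_prod_type, Finset.sum_comm]
  simp [Fintype.sum_sum_type]

theorem simulation_norm_balance (k : ℕ) :
    ∑ c, ‖(N.simulation U hU).superposition w k c‖ ^ 2 =
      (N.simulation U hU).acceptAt w k + N.simulationRejectAt hU w k +
        ∑ c, ‖(N.simulation U hU).superposition w (k + 1) c‖ ^ 2 := by
  rw [← sum_norm_sq_configMatrix_mulVec, simulation_acceptAt, simulationRejectAt]
  simp only [← simulation_mulVec_inr]
  rw [Fintype.sum_prod_type, Finset.sum_comm, Fintype.sum_prod_type,
    Finset.sum_comm (s := Finset.univ (α := S ⊕ (S ⊕ S))), ← Finset.sum_add_distrib,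
    ← Finset.sum_add_distrib]
  refine Finset.sum_congr rfl fun i _ => ?_
  simp only [Fintype.sum_sum_type, simulation_superposition_inr]
  simp [simulation_superposition_succ_inl_eq_mulVec]
  ring

/-- Up to the factor `ε ^ k`, the amplitude of a nonhalting configuration counts the runs that lead
to it. -/
theorem simulation_superposition_inl {ε : ℝ} (hε : 0 < ε)
    (hstep : ∀ σ s s', N.step σ s s' → U σ (Sum.inl s') (Sum.inl s) = (ε : ℂ))
    (hnot : ∀ σ s s', ¬ N.step σ s s' → U σ (Sum.inl s') (Sum.inl s) = 0) (k : ℕ) :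
    ∃ r : Config S w → ℝ, ∀ c, (N.simulation U hU).superposition w k (Sum.inl c.1, c.2) = r c ∧
      0 ≤ r c ∧ (0 < r c ↔ N.Reaches w k c) := by
  classical
  induction k with
  | zero =>
    refine ⟨fun c => if c = (N.start, 0) then 1 else 0, fun c => ?_⟩
    by_cases hc : c = (N.start, 0)
    · subst hc
      simp [superposition, Reaches]
    · have : ((Sum.inl c.1, c.2) : Config (S ⊕ (S ⊕ S)) w) ≠ (Sum.inl N.start, 0) := by
        simpa [Prod.ext_iff] using hc
      simp [superposition, Reaches, hc, this]
  | succ k ih =>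
    obtain ⟨r, hr⟩ := ih
    refine ⟨fun c => ∑ c' : Config S w, if N.step (tape w c'.2) c'.1 c.1 ∧
        c.2 = shift (N.move c.1) c'.2 then ε * r c' else 0, fun c => ?_⟩
    have hnonneg : ∀ c' : Config S w, 0 ≤ if N.step (tape w c'.2) c'.1 c.1 ∧
        c.2 = shift (N.move c.1) c'.2 then ε * r c' else 0 := by
      intro c'
      split_ifs
      · exact mul_nonneg hε.le (hr c').2.1
      · exact le_rfl
    refine ⟨?_, Finset.sum_nonneg fun c' _ => hnonneg c', ?_⟩
    · rw [simulation_superposition_succ_inl]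
      push_cast
      refine Finset.sum_congr rfl fun c' _ => ?_
      rw [(hr c').1]
      by_cases h₁ : N.step (tape w c'.2) c'.1 c.1
      · rw [hstep _ _ _ h₁]
        simp only [h₁, true_and]
        split_ifs <;> simp
      · simp [h₁, hnot _ _ _ h₁]
    · rw [Finset.sum_pos_iff_of_nonneg fun c' _ => hnonneg c', Reaches]
      refine exists_congr fun c' => ?_
      rw [← (hr c').2.2]
      split_ifs with h
      · simp [hε, h]
      · simp only [Finset.mem_univ, lt_irrefl, and_false, false_iff]
        exact fun h' => h h'.2

theorem tape_eq_rightEnd_iff (i : Fin (w.length + 2)) :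
    tape w i = TapeSymbol.rightEnd ↔ i = Fin.last _ := by
  unfold tape
  rw [Fin.ext_iff, Fin.val_last]
  split_ifs with h
  · simp [h]
  · rcases lt_or_ge ((i : ℕ) - 1) w.length with h' | h'
    · simp [List.getElem?_eq_getElem h']
      omega
    · simp [List.getElem?_eq_none h']
      omega

/-- Every one-way nondeterministic machine with two marked states is simulated by a 1KWQFA whose
acceptance probability exceeds `1 / 2` exactly if runs ending in the two states can arrive at the
right end marker simultaneously. -/
theorem exists_simulation (p q : S) :
    ∃ M : OneWayKWQFA α (S ⊕ (S ⊕ S)), M.StaysOnTape ∧ ∀ w : List α,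
      ((∃ k, N.Reaches w k (p, Fin.last _) ∧ N.Reaches w k (q, Fin.last _)) →
        1 / 2 < M.acceptProb w) ∧
      ((¬ ∃ k, N.Reaches w k (p, Fin.last _) ∧ N.Reaches w k (q, Fin.last _)) →
        M.acceptProb w = 1 / 2) := by
  obtain ⟨ε, hε, η, hη, U, hU, hstep, hnot, hhalt, hbal, hend⟩ := N.exists_unitary p q
  refine ⟨N.simulation U hU, fun w k q' hq' => ?_, fun w => ?_⟩
  · rw [Fintype.sum_sum_type]
    rcases q' with s' | h
    · simp [hnot _ _ _ (N.not_step_rightEnd _ s')]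
    · simp at hq'
  set M := N.simulation U hU with hM
  choose r hr using fun k => N.simulation_superposition_inl hU w hε hstep hnot k
  set P : ℕ → ℝ := fun k => ∑ c, ‖M.superposition w k c‖ ^ 2 with hP
  -- the surplus of acceptance over rejection
  set d : ℕ → ℝ := fun k => η * (r k (p, Fin.last _) * r k (q, Fin.last _)) with hd
  have hd0 : ∀ k, 0 ≤ d k := fun k =>
    mul_nonneg hη.le (mul_nonneg (hr k _).2.1 (hr k _).2.1)
  have hdpos : ∀ k, 0 < d k ↔ N.Reaches w k (p, Fin.last _) ∧ N.Reaches w k (q, Fin.last _) := by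
    intro k
    rw [← (hr k _).2.2, ← (hr k _).2.2]
    refine ⟨fun h => ?_, fun h => mul_pos hη (mul_pos h.1 h.2)⟩
    have h' := (mul_pos_iff_of_pos_left hη).mp h
    exact ⟨pos_of_mul_pos_left h' (hr k _).2.1, pos_of_mul_pos_right h' (hr k _).2.1⟩
  have hdiff : ∀ k, M.acceptAt w k = N.simulationRejectAt hU w k + d k := by
    intro k
    have hd_eq : d k = ∑ i, if i = Fin.last (w.length + 1) then d k else 0 := by simp
    rw [hM, simulation_acceptAt, simulationRejectAt, hd_eq, ← Finset.sum_add_distrib]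
    refine Finset.sum_congr rfl fun i _ => ?_
    split_ifs with hi
    · rw [(tape_eq_rightEnd_iff w i).mpr hi, hend, hi, (hr k (p, Fin.last _)).1,
        (hr k (q, Fin.last _)).1]
      simp [hd]
    · rw [add_zero]
      exact hbal _ (fun h => hi ((tape_eq_rightEnd_iff w i).mp h)) _
  have hdecay : ∀ k, P (k + 1) ≤ 1 / 2 * P k := by
    intro k
    have h₁ := N.simulation_norm_balance hU w k
    have h₂ : 1 / 2 * P k ≤ M.acceptAt w k + N.simulationRejectAt hU w k := by
      simp only [hP]
      rw [hM, simulation_acceptAt, simulationRejectAt, simulation_sum_norm_sq, Finset.mul_sum,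
        ← Finset.sum_add_distrib]
      exact Finset.sum_le_sum fun i _ => hhalt _ _
    have h₃ : P k = M.acceptAt w k + N.simulationRejectAt hU w k + P (k + 1) := h₁
    linarith
  have hP0 : ∀ k, 0 ≤ P k := fun k => Finset.sum_nonneg fun c _ => by positivity
  have hPstart : P 0 = 1 := by
    simp only [hP, superposition]
    rw [Finset.sum_eq_single ((M.start, 0) : Config (S ⊕ (S ⊕ S)) w)]
    · simp
    · intro c _ hc
      simp [hc]
    · simp
  have hPle : ∀ k, P k ≤ (1 / 2) ^ k := by
    intro k
    induction k with
    | zero => simp [hPstart]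
    | succ k ih =>
      rw [pow_succ']
      linarith [hdecay k]
  have hPlim : Filter.Tendsto P Filter.atTop (nhds 0) :=
    squeeze_zero hP0 hPle (tendsto_pow_atTop_nhds_zero_of_lt_one (by norm_num) (by norm_num))
  have htele : HasSum (fun k => P k - P (k + 1)) 1 := by
    rw [hasSum_iff_tendsto_nat_of_nonneg fun k => by linarith [hdecay k, hP0 k]]
    simp only [Finset.sum_range_sub', hPstart]
    simpa using hPlim.const_sub 1
  have hacc : ∀ k, 2 * M.acceptAt w k = (P k - P (k + 1)) + d k := by
    intro k
    have h₁ : P k = M.acceptAt w k + N.simulationRejectAt hU w k + P (k + 1) :=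
      N.simulation_norm_balance hU w k
    linarith [hdiff k]
  have hdsum : Summable d := by
    have := ((M.summable_acceptAt w).mul_left 2).sub htele.summable
    refine this.congr fun k => ?_
    rw [hacc]
    ring
  have hprob : 2 * M.acceptProb w = 1 + ∑' k, d k := by
    rw [acceptProb, ← tsum_mul_left, tsum_congr hacc, htele.summable.tsum_add hdsum, htele.tsum_eq]
  constructor
  · rintro ⟨k, hk⟩
    have := hdsum.tsum_pos hd0 k ((hdpos k).mpr hk)
    linarith
  · intro h
    have hzero : ∀ k, d k = 0 := fun k =>
      le_antisymm (not_lt.mp fun hk => h ⟨k, (hdpos k).mp hk⟩) (hd0 k)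
    rw [tsum_congr hzero, tsum_zero] at hprob
    linarith

end OneWayNFA

/-! ### Runs described by the part of the input read -/

namespace OneWayNFA

open OneWayKWQFA

variable {α S : Type}

theorem tape_of_prefix {u w : List α} {l : α} (h : u ++ [l] <+: w)
    (hi : u.length + 1 < w.length + 2) :
    tape w ⟨u.length + 1, hi⟩ = TapeSymbol.letter l := by
  obtain ⟨t, rfl⟩ := h
  simp [tape]

theorem val_shift_right {n : ℕ} {i : Fin (n + 2)} (hi : (i : ℕ) < n + 1) :
    ((shift HeadMove.right i : Fin (n + 2)) : ℕ) = i + 1 :=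
  Fin.val_add_one_of_lt (Fin.lt_def.mpr (by simpa using hi))

/-- On all inputs beginning with `u`, some run arrives in the state `s`, just after having read `u`,
at time `k`. -/
def Arrives (N : OneWayNFA α S) (u : List α) (k : ℕ) (s : S) : Prop :=
  ∀ w, u <+: w → ∃ h : u.length + 1 < w.length + 2, N.Reaches w k (s, ⟨u.length + 1, h⟩)

variable {N : OneWayNFA α S} {u : List α} {k : ℕ} {s s' s'' : S} {l : α}

theorem arrives_nil (h : N.step TapeSymbol.leftEnd N.start s) (hs : N.move s = HeadMove.right) :
    N.Arrives [] 1 s := by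
  intro w _
  refine ⟨by simp, (N.start, 0), rfl, ?_, ?_⟩
  · simpa [tape] using h
  · rw [hs]
    exact Fin.ext (by rw [val_shift_right] <;> simp)

theorem Arrives.right (h : N.Arrives u k s) (hstep : N.step (TapeSymbol.letter l) s s')
    (hs' : N.move s' = HeadMove.right) : N.Arrives (u ++ [l]) (k + 1) s' := by
  intro w hw
  obtain ⟨hi, hr⟩ := h w ((List.prefix_append u [l]).trans hw)
  have hlen : u.length + 1 ≤ w.length := by simpa using hw.length_le
  refine ⟨by simpa using hlen, _, hr, ?_, ?_⟩
  · rwa [tape_of_prefix hw]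
  · rw [hs']
    refine Fin.ext ?_
    rw [val_shift_right (by simpa using hlen)]
    simp

theorem Arrives.stay_right (h : N.Arrives u k s) (hstep : N.step (TapeSymbol.letter l) s s')
    (hs' : N.move s' = HeadMove.stay) (hstep' : N.step (TapeSymbol.letter l) s' s'')
    (hs'' : N.move s'' = HeadMove.right) : N.Arrives (u ++ [l]) (k + 2) s'' := by
  intro w hw
  obtain ⟨hi, hr⟩ := h w ((List.prefix_append u [l]).trans hw)
  have hlen : u.length + 1 ≤ w.length := by simpa using hw.length_le
  refine ⟨by simpa using hlen, (s', ⟨u.length + 1, hi⟩), ⟨_, hr, ?_, ?_⟩, ?_, ?_⟩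
  · rwa [tape_of_prefix hw]
  · rw [hs']
    rfl
  · rwa [tape_of_prefix hw]
  · rw [hs'']
    refine Fin.ext ?_
    rw [val_shift_right (by simpa using hlen)]
    simp

theorem Arrives.reaches_last {w : List α} (h : N.Arrives w k s) :
    N.Reaches w k (s, Fin.last _) :=
  (h w (List.prefix_refl w)).2

/-- Induction principle for the runs of a machine that leaves `¢` in its first step: `Φ s u k` is
preserved by the steps on the input letters, where `u` is the part of the input to the left of the
head. -/
theorem Reaches.induction {Φ : S → List α → ℕ → Prop}
    (hstart : ∀ s, N.step TapeSymbol.leftEnd N.start s → N.move s = HeadMove.right ∧ Φ s [] 1)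
    (hstay : ∀ l s s' u k, N.step (TapeSymbol.letter l) s s' → N.move s' = HeadMove.stay →
      Φ s u k → Φ s' u (k + 1))
    (hright : ∀ l s s' u k, N.step (TapeSymbol.letter l) s s' → N.move s' = HeadMove.right →
      Φ s u k → Φ s' (u ++ [l]) (k + 1)) {w : List α} {k : ℕ} {c : Config S w}
    (hc : N.Reaches w k c) :
    c = (N.start, 0) ∨ ∃ u v, w = u ++ v ∧ (c.2 : ℕ) = u.length + 1 ∧ Φ c.1 u k := by
  suffices H : (k = 0 ∧ c = (N.start, 0)) ∨
      ∃ u v, w = u ++ v ∧ (c.2 : ℕ) = u.length + 1 ∧ Φ c.1 u k from H.imp_left And.right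
  induction k generalizing c with
  | zero => exact Or.inl ⟨rfl, hc⟩
  | succ k ih =>
    right
    obtain ⟨⟨s, i⟩, hr, hstep, hpos⟩ := hc
    obtain ⟨s', j⟩ := c
    dsimp only at hstep hpos ⊢
    rcases ih hr with ⟨rfl, h⟩ | ⟨u, v, rfl, hi, hΦ⟩
    · obtain ⟨rfl, rfl⟩ := Prod.mk.inj h
      obtain ⟨hmove, hΦ⟩ := hstart s' (by simpa [tape] using hstep)
      refine ⟨[], w, rfl, ?_, hΦ⟩
      rw [hpos, hmove, val_shift_right (by simp)]
      simp
    · dsimp only at hi hΦ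
      rcases v with _ | ⟨l, v⟩
      · refine absurd hstep ?_
        rw [(tape_eq_rightEnd_iff _ i).mpr (Fin.ext (by simp [hi]))]
        exact N.not_step_rightEnd _ _
      · have hi' : i = ⟨u.length + 1, by simp⟩ := Fin.ext hi
        rw [hi', tape_of_prefix (l := l) (by simp)] at hstep
        rcases hmove : N.move s' with _ | _
        · refine ⟨u, l :: v, rfl, ?_, hstay l s s' u k hstep hmove hΦ⟩
          rw [hpos, hmove]
          exact hi
        · refine ⟨u ++ [l], v, by simp, ?_, hright l s s' u k hstep hmove hΦ⟩
          rw [hpos, hmove, val_shift_right (by simp [hi]), hi]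
          simp

end OneWayNFA

/-! ### Words made of unary blocks -/

/-- The word `a^{y₁} b ⋯ a^{y_t} b`. -/
def unaryBlocks (ys : List ℕ) : List AB :=
  ys.flatMap fun i => List.replicate i AB.a ++ [AB.b]

@[simp]
theorem unaryBlocks_nil : unaryBlocks [] = [] := rfl

theorem unaryBlocks_cons (y : ℕ) (ys : List ℕ) :
    unaryBlocks (y :: ys) = List.replicate y AB.a ++ AB.b :: unaryBlocks ys := by
  simp [unaryBlocks]

theorem unaryBlocks_append (ys zs : List ℕ) :
    unaryBlocks (ys ++ zs) = unaryBlocks ys ++ unaryBlocks zs := by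
  simp [unaryBlocks]

theorem count_unaryBlocks (ys : List ℕ) : (unaryBlocks ys).count AB.a = ys.sum := by
  induction ys with
  | nil => rfl
  | cons y ys ih => simp [unaryBlocks_cons, ih]

theorem exists_unaryBlocks_eq_append {ys : List ℕ} (h : ys ≠ []) :
    ∃ v, unaryBlocks ys = v ++ [AB.b] := by
  induction ys using List.reverseRecOn with
  | nil => exact absurd rfl h
  | append_singleton ys y _ =>
    exact ⟨unaryBlocks ys ++ List.replicate y AB.a, by
      simp [unaryBlocks_append, unaryBlocks_cons]⟩

theorem exists_take_sum_eq_count {ys : List ℕ} {v z : List AB}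
    (h : unaryBlocks ys = v ++ AB.b :: z) :
    ∃ k, 1 ≤ k ∧ k ≤ ys.length ∧ (ys.take k).sum = v.count AB.a := by
  induction ys generalizing v with
  | nil => simp at h
  | cons y ys ih =>
    rw [unaryBlocks_cons, List.append_eq_append_iff] at h
    rcases h with ⟨t, rfl, ht⟩ | ⟨t, ht, ht'⟩
    · rcases t with _ | ⟨l, t⟩
      · exact ⟨1, le_rfl, by simp, by simp⟩
      · obtain ⟨k, -, hk, hsum⟩ := ih (List.cons.inj ht).2
        obtain rfl : AB.b = l := (List.cons.inj ht).1
        exact ⟨k + 1, by omega, by simpa using hk, by simp [hsum]⟩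
    · have hcount := congrArg (List.count AB.a) ht
      rcases t with _ | ⟨l, t⟩
      · exact ⟨1, le_rfl, by simp, by simpa using hcount⟩
      · obtain rfl : AB.b = l := (List.cons.inj ht').1
        have hb : AB.b ∈ List.replicate y AB.a := by simp [ht]
        simp at hb

theorem replicate_append_b_inj {m n : ℕ} {u v : List AB}
    (h : List.replicate m AB.a ++ AB.b :: u = List.replicate n AB.a ++ AB.b :: v) :
    m = n ∧ u = v := by
  induction m generalizing n with
  | zero => cases n <;> simp_all [List.replicate_succ]
  | succ m ih =>
    cases n with
    | zero => simp [List.replicate_succ] at h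
    | succ n => simpa using ih (by simpa [List.replicate_succ] using h)

/-! ### The nondeterministic machine for the language -/

/-- The states of the nondeterministic machine for `LNH`. After leaving `start` it is either in the
format component `headSlow`, …, `blockEnd`, or in the sum component `headFast`, …, `tail`. -/
inductive LNHState
  | start
  /-- in the block `a^x`, each letter of which takes two steps -/
  | headSlow
  /-- in the middle of reading a letter of the block `a^x` -/
  | headPause
  /-- after the `b` that follows `a^x` -/
  | headEnd
  /-- inside a block `a^{y_i}`, after at least one letter -/
  | inBlock
  /-- after the `b` that follows `a^{y_i}` -/
  | blockEnd
  /-- in the block `a^x`, each letter of which takes one step -/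
  | headFast
  /-- after `a^x b`, while each letter `a` takes two steps -/
  | sumSlow
  /-- in the middle of reading a letter `a` after `a^x b` -/
  | sumPause
  /-- after the guessed `b`, where all letters take one step -/
  | tail
  deriving DecidableEq

namespace LNHState

instance : Fintype LNHState where
  elems := {start, headSlow, headPause, headEnd, inBlock, blockEnd, headFast, sumSlow, sumPause, tail}
  complete s := by cases s <;> decide

/-- The steps of the nondeterministic machine for `LNH`. -/
inductive Step : TapeSymbol AB → LNHState → LNHState → Prop
  | start_headSlow : Step .leftEnd start headSlow
  | start_headFast : Step .leftEnd start headFast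
  | headSlow_a : Step (.letter .a) headSlow headPause
  | headPause_a : Step (.letter .a) headPause headSlow
  | headSlow_b : Step (.letter .b) headSlow headEnd
  | headEnd_a : Step (.letter .a) headEnd inBlock
  | inBlock_a : Step (.letter .a) inBlock inBlock
  | inBlock_b : Step (.letter .b) inBlock blockEnd
  | blockEnd_a : Step (.letter .a) blockEnd inBlock
  | headFast_a : Step (.letter .a) headFast headFast
  | headFast_b : Step (.letter .b) headFast sumSlow
  | sumSlow_a : Step (.letter .a) sumSlow sumPause
  | sumPause_a : Step (.letter .a) sumPause sumSlow
  | sumSlow_b : Step (.letter .b) sumSlow sumSlow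
  | sumSlow_tail : Step (.letter .b) sumSlow tail
  | tail_a : Step (.letter .a) tail tail
  | tail_b : Step (.letter .b) tail tail

end LNHState

open LNHState

/-- The nondeterministic machine for `LNH`. The format component checks that the input has the form
`a^x b a^{y₁} b ⋯ a^{y_t} b`, and spends an additional step on each letter of `a^x`. The sum
component guesses a later `b`, and spends an additional step on each `a` between the first and the
guessed `b`. -/
def lnhMachine : OneWayNFA AB LNHState where
  step := Step
  move
    | headPause | sumPause => HeadMove.stay
    | _ => HeadMove.right
  start := start
  not_step_rightEnd _ _ h := by cases h

/-- The prefixes `u` of the input which `lnhMachine` can have read in a given state at time `k`. -/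
def lnhInvariant : LNHState → List AB → ℕ → Prop
  | start, _, _ => False
  | headSlow, u, k => ∃ n, u = List.replicate n AB.a ∧ k = 1 + 2 * n
  | headPause, u, k => ∃ n, u = List.replicate n AB.a ∧ k = 2 + 2 * n
  | headEnd, u, k => ∃ n, u = List.replicate n AB.a ++ AB.b :: [] ∧ k = u.length + 1 + n
  | inBlock, u, k => ∃ n ys m, (∀ y ∈ ys, 0 < y) ∧ 0 < m ∧
      u = List.replicate n AB.a ++ AB.b :: (unaryBlocks ys ++ List.replicate m AB.a) ∧
      k = u.length + 1 + n
  | blockEnd, u, k => ∃ n ys, (∀ y ∈ ys, 0 < y) ∧ ys ≠ [] ∧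
      u = List.replicate n AB.a ++ AB.b :: unaryBlocks ys ∧ k = u.length + 1 + n
  | headFast, u, k => ∃ n, u = List.replicate n AB.a ∧ k = 1 + n
  | sumSlow, u, k => ∃ n v, u = List.replicate n AB.a ++ AB.b :: v ∧
      k = u.length + 1 + v.count AB.a
  | sumPause, u, k => ∃ n v, u = List.replicate n AB.a ++ AB.b :: v ∧
      k = u.length + 2 + v.count AB.a
  | tail, u, k => ∃ n v z, u = List.replicate n AB.a ++ AB.b :: (v ++ AB.b :: z) ∧
      k = u.length + 1 + v.count AB.a

theorem lnhMachine_reaches {w : List AB} {k : ℕ} {c : OneWayKWQFA.Config LNHState w}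
    (hc : lnhMachine.Reaches w k c) :
    c = (start, 0) ∨ ∃ u v, w = u ++ v ∧ (c.2 : ℕ) = u.length + 1 ∧ lnhInvariant c.1 u k := by
  -- Each clause goes through the transitions in the order of the constructors of `Step`.
  refine hc.induction ?_ ?_ ?_
  · intro s hs
    cases hs
    · exact ⟨rfl, 0, rfl, rfl⟩
    · exact ⟨rfl, 0, rfl, rfl⟩
  · intro l s s' u k hstep hmove h
    cases hstep <;> try cases hmove
    · obtain ⟨n, rfl, rfl⟩ := h
      exact ⟨n, rfl, by ring⟩
    · obtain ⟨n, v, hu, rfl⟩ := h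
      exact ⟨n, v, hu, by ring⟩
  · intro l s s' u k hstep hmove h
    cases hstep <;> try cases hmove
    · obtain ⟨n, rfl, rfl⟩ := h
      exact ⟨n + 1, List.replicate_succ'.symm, by ring⟩
    · obtain ⟨n, rfl, rfl⟩ := h
      exact ⟨n, rfl, by simp; ring⟩
    · obtain ⟨n, rfl, rfl⟩ := h
      exact ⟨n, [], 1, by simp, one_pos, by simp, by simp; ring⟩
    · obtain ⟨n, ys, m, hys, hm, rfl, rfl⟩ := h
      exact ⟨n, ys, m + 1, hys, by omega, by simp [List.replicate_succ'], by simp; ring⟩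
    · obtain ⟨n, ys, m, hys, hm, rfl, rfl⟩ := h
      refine ⟨n, ys ++ [m], ?_, by simp, by simp [unaryBlocks_append, unaryBlocks_cons],
        by simp; ring⟩
      intro y hy
      rcases List.mem_append.mp hy with hy | hy
      · exact hys y hy
      · rwa [List.mem_singleton.mp hy]
    · obtain ⟨n, ys, hys, hne, rfl, rfl⟩ := h
      exact ⟨n, ys, 1, hys, one_pos, by simp, by simp; ring⟩
    · obtain ⟨n, rfl, rfl⟩ := h
      exact ⟨n + 1, List.replicate_succ'.symm, by ring⟩
    · obtain ⟨n, rfl, rfl⟩ := h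
      exact ⟨n, [], rfl, by simp; ring⟩
    · obtain ⟨n, v, rfl, rfl⟩ := h
      exact ⟨n, v ++ [AB.a], by simp, by simp; ring⟩
    · obtain ⟨n, v, rfl, rfl⟩ := h
      exact ⟨n, v ++ [AB.b], by simp, by simp; ring⟩
    · obtain ⟨n, v, rfl, rfl⟩ := h
      exact ⟨n, v, [], by simp, by simp; ring⟩
    · obtain ⟨n, v, z, rfl, rfl⟩ := h
      exact ⟨n, v, z ++ [AB.a], by simp, by simp; ring⟩
    · obtain ⟨n, v, z, rfl, rfl⟩ := h
      exact ⟨n, v, z ++ [AB.b], by simp, by simp; ring⟩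

theorem lnhMachine_invariant_of_reaches_last {w : List AB} {k : ℕ} {s : LNHState}
    (h : lnhMachine.Reaches w k (s, Fin.last _)) : lnhInvariant s w k := by
  rcases lnhMachine_reaches h with h | ⟨u, v, rfl, hlen, hs⟩
  · exact absurd (congrArg Prod.snd h) (Fin.last_pos.ne')
  · obtain rfl : v = [] := by simpa using hlen
    simpa using hs

theorem lnhMachine_arrives_headSlow (n : ℕ) :
    lnhMachine.Arrives (List.replicate n AB.a) (1 + 2 * n) headSlow := by
  induction n with
  | zero => exact OneWayNFA.arrives_nil Step.start_headSlow rfl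
  | succ n ih =>
    rw [List.replicate_succ']
    exact ih.stay_right Step.headSlow_a rfl Step.headPause_a rfl

theorem lnhMachine_arrives_headFast (n : ℕ) :
    lnhMachine.Arrives (List.replicate n AB.a) (1 + n) headFast := by
  induction n with
  | zero => exact OneWayNFA.arrives_nil Step.start_headFast rfl
  | succ n ih =>
    rw [List.replicate_succ']
    exact ih.right Step.headFast_a rfl

theorem lnhMachine_arrives_inBlock {u : List AB} {k : ℕ} (h : lnhMachine.Arrives u k inBlock)
    (m : ℕ) : lnhMachine.Arrives (u ++ List.replicate m AB.a) (k + m) inBlock := by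
  induction m with
  | zero => simpa using h
  | succ m ih =>
    rw [List.replicate_succ', ← List.append_assoc]
    exact ih.right Step.inBlock_a rfl

theorem lnhMachine_arrives_block {u : List AB} {k : ℕ} {s : LNHState}
    (h : lnhMachine.Arrives u k s) (hs : Step (.letter .a) s inBlock) {m : ℕ} (hm : 0 < m) :
    lnhMachine.Arrives (u ++ (List.replicate m AB.a ++ [AB.b])) (k + (m + 1)) blockEnd := by
  obtain ⟨m, rfl⟩ := Nat.exists_eq_succ_of_ne_zero hm.ne'
  have := (lnhMachine_arrives_inBlock (h.right (l := AB.a) (s' := inBlock) hs rfl) m).right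
    Step.inBlock_b rfl
  convert this using 1
  · simp [List.replicate_succ]
  · simp only [Nat.succ_eq_add_one]
    ring

theorem lnhMachine_arrives_blockEnd {ys : List ℕ} (hys : ∀ y ∈ ys, 0 < y) (hne : ys ≠ [])
    {u : List AB} {k : ℕ} {s : LNHState} (h : lnhMachine.Arrives u k s)
    (hs : Step (.letter .a) s inBlock) :
    lnhMachine.Arrives (u ++ unaryBlocks ys) (k + (unaryBlocks ys).length) blockEnd := by
  induction ys generalizing u k s with
  | nil => exact absurd rfl hne
  | cons y ys ih =>
    have hy := lnhMachine_arrives_block h hs (hys y (by simp))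
    rcases eq_or_ne ys [] with rfl | hne'
    · simpa [unaryBlocks_cons] using hy
    · convert ih (fun z hz => hys z (by simp [hz])) hne' hy Step.blockEnd_a using 1
      · simp [unaryBlocks_cons]
      · simp [unaryBlocks_cons]
        ring

theorem lnhMachine_arrives_sumSlow {u : List AB} {k : ℕ} (h : lnhMachine.Arrives u k sumSlow)
    (v : List AB) :
    lnhMachine.Arrives (u ++ v) (k + v.length + v.count AB.a) sumSlow := by
  induction v using List.reverseRecOn with
  | nil => simpa using h
  | append_singleton v l ih =>
    rw [← List.append_assoc]
    cases l with
    | a =>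
      convert ih.stay_right Step.sumSlow_a rfl Step.sumPause_a rfl using 1
      simp
      ring
    | b =>
      convert ih.right (l := AB.b) (s' := sumSlow) Step.sumSlow_b rfl using 1
      simp
      ring

theorem lnhMachine_arrives_tail {u : List AB} {k : ℕ} (h : lnhMachine.Arrives u k tail)
    (z : List AB) : lnhMachine.Arrives (u ++ z) (k + z.length) tail := by
  induction z using List.reverseRecOn with
  | nil => simpa using h
  | append_singleton z l ih =>
    rw [← List.append_assoc, List.length_append, ← add_assoc]
    cases l with
    | a => exact ih.right Step.tail_a rfl
    | b => exact ih.right Step.tail_b rfl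

theorem mem_LNH_iff {w : List AB} : w ∈ LNH ↔ ∃ (x : ℕ) (ys : List ℕ), 0 < x ∧ ys ≠ [] ∧
    (∀ y ∈ ys, 0 < y) ∧ (∃ k, 1 ≤ k ∧ k ≤ ys.length ∧ x = (ys.take k).sum) ∧
    w = List.replicate x AB.a ++ AB.b :: unaryBlocks ys := by
  have h : ∀ (x : ℕ) (ys : List ℕ), List.replicate x AB.a ++ AB.b :: unaryBlocks ys =
      List.replicate x AB.a ++ [AB.b] ++ unaryBlocks ys := by simp
  simp only [h]
  rfl

/-- On an input of the right form the format component arrives at `$` at time `|w| + 1 + x`, and the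
sum component at the times `|w| + 1 + y₁ + ⋯ + y_k`. -/
theorem lnhMachine_simultaneous_iff (w : List AB) :
    (∃ k, lnhMachine.Reaches w k (blockEnd, Fin.last _) ∧
      lnhMachine.Reaches w k (tail, Fin.last _)) ↔ w ∈ LNH := by
  rw [mem_LNH_iff]
  constructor
  · rintro ⟨k, hblock, htail⟩
    obtain ⟨n, ys, hys, hne, hw, hk⟩ := lnhMachine_invariant_of_reaches_last hblock
    obtain ⟨n', v, z, hw', hk'⟩ := lnhMachine_invariant_of_reaches_last htail
    obtain ⟨rfl, hvz⟩ := replicate_append_b_inj (hw.symm.trans hw')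
    obtain ⟨i, hi₁, hi, hsum⟩ := exists_take_sum_eq_count hvz
    -- the arrival times `|w| + 1 + n` and `|w| + 1 + v.count a` agree
    have hn : n = (ys.take i).sum := by omega
    refine ⟨n, ys, ?_, hne, hys, ⟨i, hi₁, hi, hn⟩, hw⟩
    rw [hn]
    refine List.sum_pos _ (fun y hy => hys y (List.mem_of_mem_take hy)) ?_
    simp only [ne_eq, List.take_eq_nil_iff, not_or]
    exact ⟨by omega, hne⟩
  · rintro ⟨x, ys, -, hne, hys, ⟨i, hi₁, hi, hx⟩, rfl⟩
    obtain ⟨v, hv⟩ := exists_unaryBlocks_eq_append (ys := ys.take i) (by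
      simp only [ne_eq, List.take_eq_nil_iff, not_or]
      exact ⟨by omega, hne⟩)
    have hblocks : unaryBlocks ys = v ++ [AB.b] ++ unaryBlocks (ys.drop i) := by
      rw [← hv, ← unaryBlocks_append, List.take_append_drop]
    have hcount : v.count AB.a = x := by
      rw [hx, ← count_unaryBlocks, hv]
      simp
    refine ⟨2 + 2 * x + (unaryBlocks ys).length, ?_, ?_⟩ <;>
      refine OneWayNFA.Arrives.reaches_last ?_
    · convert lnhMachine_arrives_blockEnd hys hne ((lnhMachine_arrives_headSlow x).right
        (l := AB.b) (s' := headEnd) Step.headSlow_b rfl) Step.headEnd_a using 1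
      · simp
      · ring
    · convert lnhMachine_arrives_tail ((lnhMachine_arrives_sumSlow
        ((lnhMachine_arrives_headFast x).right (l := AB.b) (s' := sumSlow) Step.headFast_b rfl)
        v).right (l := AB.b) (s' := tail) Step.sumSlow_tail rfl) (unaryBlocks (ys.drop i)) using 1
      · simp [hblocks]
      · simp [hblocks, hcount]
        ring

theorem theorem1 :
    ∃ (Q : Type) (_ : Fintype Q) (_ : DecidableEq Q) (M : OneWayKWQFA AB Q),
      M.StaysOnTape ∧
      M.RecognizesWithUnboundedError LNH ∧
      (∀ w : List AB, w ∉ LNH → M.acceptProb w = 1 / 2) ∧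
      (∀ w : List AB, w ∈ LNH → 1 / 2 < M.acceptProb w) := by
  obtain ⟨M, htape, hM⟩ := lnhMachine.exists_simulation blockEnd tail
  simp only [lnhMachine_simultaneous_iff] at hM
  refine ⟨_, inferInstance, inferInstance, M, htape, ⟨1 / 2, Or.inl fun w => ?_⟩,
    fun w => (hM w).2, fun w => (hM w).1⟩
  refine ⟨(hM w).1, fun h => ?_⟩
  by_contra hw
  exact h.ne' ((hM w).2 hw)
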